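/- \textbf{Theorem (Operator-norm convergence).} A graphon is a symmetric measurable function $W:[0,1]^2\to[0,1]$; its integral operator on $L^2([0,1])$ is $(T_Wf)(x)=\int_0^1 W(x,y)f(y)\,dy$. For points $u_1,\dots,u_n\in[0,1]$ ($n\ge 1$) with order statistics $u_{(1)}\le\dots\le u_{(n)}$, let $W_n$ be the step graphon with $W_n(x,y)=W(u_{(i)},u_{(j)})$ for $(x,y)\in I_i\times I_j$, where $I_i=((i-1)/n,i/n]$ (and $W_n=0$ on the null set where $x=0$ or $y=0$), and put $\varepsilon_n=\|T_{W_n}-T_W\|_{L^2\to L^2}$. Equivalently, $W_n$ is the step graphon of the matrix $A_{ij}=W(u_i,u_j)$ after sorting the sample. There is a universal constant $C>0$ such that, for every graphon $W$ and every $L$ with \[ |W(x,y)-W(x',y')|\le L\bigl(|x-x'|+|y-y'|\bigr)\qquad\text{for all }(x,y),(x',y')\in[0,1]^2, \] every $n\ge 1$, every i.i.d. sample $u_1,\dots,u_n$ uniform on $[0,1]$, and every $\delta\in(0,1)$, with probability at least $1-\delta$, \[ \varepsilon_n\le C L\Bigl(\sqrt{\tfrac{\log(2/\delta)}{n}}+\tfrac1n\Bigr).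 \] In particular (taking $\delta=n^{-c}$), for every $c>0$ there is a constant $K>0$ depending only on $c$ such that, for all such $W$, $L$, samples and all $n\ge 2$, $\varepsilon_n\le K L\sqrt{\log n/n}$ with probability at least $1-n^{-c}$; and for each fixed Lipschitz graphon $W$, $\varepsilon_n=O_p\bigl(\sqrt{\log n/n}\bigr)$ as $n\to\infty$, that is, for every $\eta>0$ there is $M>0$ such that $\Pr\bigl(\varepsilon_n>M\sqrt{\log n/n}\bigr)\le\eta$ for all sufficiently large $n$. -/

import Mathlib

open MeasureTheory ProbabilityTheory Filter
open scoped unitInterval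

/-- A graphon: a symmetric measurable function `W : [0,1]² → [0,1]`. -/
structure Graphon where
  /-- the underlying kernel -/
  kernel : I → I → ℝ
  measurable_kernel : Measurable (Function.uncurry kernel)
  symm : ∀ x y, kernel x y = kernel y x
  mem_Icc : ∀ x y, kernel x y ∈ Set.Icc (0 : ℝ) 1

namespace Graphon

/-- The real Hilbert space `L²([0,1])`, for Lebesgue measure. -/
abbrev L2 : Type := Lp ℝ 2 (volume : Measure I)

lemma abs_kernel_le (W : Graphon) (x y : I) : |W.kernel x y| ≤ 1 :=
  abs_le.2 ⟨by linarith [(W.mem_Icc x y).1], (W.mem_Icc x y).2⟩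

lemma integrable_L2 (f : L2) : Integrable f volume :=
  (Lp.memLp f).integrable (by norm_num)

lemma integrable_kernel_mul (W : Graphon) (f : L2) (x : I) :
    Integrable (fun y => W.kernel x y * f y) volume := by
  refine (integrable_L2 f).bdd_mul (c := 1) ?_ ?_
  · exact (W.measurable_kernel.comp measurable_prodMk_left).aestronglyMeasurable
  · exact Eventually.of_forall fun y => by simpa using W.abs_kernel_le x y

lemma integral_norm_le (f : L2) : ∫ y, ‖f y‖ ≤ ‖f‖ := by
  have h := eLpNorm_le_eLpNorm_of_exponent_le (μ := (volume : Measure I)) (p := 1) (q := 2)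
    (by norm_num) (Lp.aestronglyMeasurable f)
  rw [integral_norm_eq_lintegral_enorm (Lp.aestronglyMeasurable f), Lp.norm_def,
    ← eLpNorm_one_eq_lintegral_enorm]
  exact ENNReal.toReal_mono (Lp.eLpNorm_ne_top f) h

/-- The function `u ↦ ∫₀¹ W(u,v) f(v) dv`. -/
noncomputable def applyFun (W : Graphon) (f : L2) (x : I) : ℝ :=
  ∫ y, W.kernel x y * f y

lemma norm_applyFun_le (W : Graphon) (f : L2) (x : I) : ‖W.applyFun f x‖ ≤ ‖f‖ := by
  refine (norm_integral_le_integral_norm _).trans (le_trans ?_ (integral_norm_le f))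
  refine integral_mono (W.integrable_kernel_mul f x).norm (integrable_L2 f).norm fun y => ?_
  simp only [norm_mul]
  exact mul_le_of_le_one_left (norm_nonneg _) (W.abs_kernel_le x y)

lemma memLp_applyFun (W : Graphon) (f : L2) : MemLp (W.applyFun f) 2 (volume : Measure I) := by
  refine MemLp.of_bound ?_ ‖f‖ (Eventually.of_forall (W.norm_applyFun_le f))
  have h : StronglyMeasurable (Function.uncurry fun x y : I => W.kernel x y * f y) :=
    W.measurable_kernel.stronglyMeasurable.mul
      ((Lp.stronglyMeasurable f).comp_measurable measurable_snd)
  exact h.integral_prod_right.aestronglyMeasurable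

/-- The integral operator `T_W : L²([0,1]) → L²([0,1])`, `(T_W f)(u) = ∫₀¹ W(u,v) f(v) dv`, as a
bounded operator; `‖·‖` on its type is the `L² → L²` operator norm. -/
noncomputable def operator (W : Graphon) : L2 →L[ℝ] L2 :=
  LinearMap.mkContinuous
    { toFun := fun f => (W.memLp_applyFun f).toLp (W.applyFun f)
      map_add' := fun f g => by
        rw [← MemLp.toLp_add]
        refine MemLp.toLp_congr _ _ (Eventually.of_forall fun x => ?_)
        simp only [applyFun, Pi.add_apply]
        rw [← integral_add (W.integrable_kernel_mul f x) (W.integrable_kernel_mul g x)]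
        refine integral_congr_ae ?_
        filter_upwards [Lp.coeFn_add f g] with y hy
        rw [hy, Pi.add_apply, mul_add]
      map_smul' := fun c f => by
        rw [RingHom.id_apply, ← MemLp.toLp_const_smul]
        refine MemLp.toLp_congr _ _ (Eventually.of_forall fun x => ?_)
        simp only [applyFun, Pi.smul_apply, smul_eq_mul]
        rw [← integral_const_mul]
        refine integral_congr_ae ?_
        filter_upwards [Lp.coeFn_smul c f] with y hy
        rw [hy, Pi.smul_apply, smul_eq_mul, mul_left_comm] }
    1 (fun f => by
      have h := Lp.norm_le_of_ae_bound (f := (W.memLp_applyFun f).toLp (W.applyFun f))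
        (norm_nonneg f) (by
          filter_upwards [(W.memLp_applyFun f).coeFn_toLp] with x hx
          rw [hx]
          exact W.norm_applyFun_le f x)
      simpa [measureUnivNNReal] using h)

lemma operator_apply_ae (W : Graphon) (f : L2) :
    W.operator f =ᵐ[volume] fun x => ∫ y, W.kernel x y * f y :=
  (W.memLp_applyFun f).coeFn_toLp

/-- `W` is Lipschitz with constant `L` for the `ℓ¹` distance on `[0,1]²`. -/
def IsLipschitz (W : Graphon) (L : ℝ) : Prop :=
  ∀ x y x' y' : I,
    |W.kernel x y - W.kernel x' y'| ≤ L * (|(x : ℝ) - x'| + |(y : ℝ) - y'|)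

/-- The cell `(i/n, (i+1)/n]` of the canonical partition, `i = 0, …, n-1`. -/
def cell (n : ℕ) (i : Fin n) : Set I :=
  {x : I | (i : ℝ) / n < x ∧ (x : ℝ) ≤ ((i : ℝ) + 1) / n}

lemma measurableSet_cell (n : ℕ) (i : Fin n) : MeasurableSet (cell n i) :=
  (measurableSet_lt measurable_const measurable_subtype_coe).inter
    (measurableSet_le measurable_subtype_coe measurable_const)

lemma cell_unique {n : ℕ} {i j : Fin n} {x : I} (hi : x ∈ cell n i) (hj : x ∈ cell n j) :
    i = j := by
  have hn : (0 : ℝ) < n := by exact_mod_cast i.pos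
  obtain ⟨h1, h2⟩ := hi
  obtain ⟨h3, h4⟩ := hj
  rw [div_lt_iff₀ hn] at h1 h3
  rw [le_div_iff₀ hn] at h2 h4
  have h5 : (i : ℝ) < (j : ℝ) + 1 := by linarith
  have h6 : (j : ℝ) < (i : ℝ) + 1 := by linarith
  have h7 : (i : ℕ) < j + 1 := by exact_mod_cast h5
  have h8 : (j : ℕ) < i + 1 := by exact_mod_cast h6
  exact Fin.ext (by omega)

/-- The step kernel equal to `A i j` on `cell i × cell j` (and to `0` on the null set where one of
the coordinates is `0`). -/
noncomputable def stepKernel {n : ℕ} (A : Matrix (Fin n) (Fin n) ℝ) (x y : I) : ℝ :=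
  ∑ i, ∑ j, A i j * (cell n i).indicator 1 x * (cell n j).indicator 1 y

lemma stepKernel_of_mem {n : ℕ} (A : Matrix (Fin n) (Fin n) ℝ) {i j : Fin n} {x y : I}
    (hx : x ∈ cell n i) (hy : y ∈ cell n j) : stepKernel A x y = A i j := by
  unfold stepKernel
  rw [Finset.sum_eq_single i, Finset.sum_eq_single j]
  · simp [hx, hy]
  · intro k _ hk
    have : y ∉ cell n k := fun h => hk (cell_unique h hy)
    simp [this]
  · simp
  · intro k _ hk
    have : x ∉ cell n k := fun h => hk (cell_unique h hx)
    simp [this]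
  · simp

lemma stepKernel_eq_zero {n : ℕ} (A : Matrix (Fin n) (Fin n) ℝ) {x y : I}
    (h : (∀ i, x ∉ cell n i) ∨ ∀ j, y ∉ cell n j) : stepKernel A x y = 0 := by
  unfold stepKernel
  refine Finset.sum_eq_zero fun i _ => Finset.sum_eq_zero fun j _ => ?_
  rcases h with h | h
  · simp [h i]
  · simp [h j]

/-- The step graphon induced by a symmetric matrix with entries in `[0,1]`. -/
noncomputable def step {n : ℕ} (A : Matrix (Fin n) (Fin n) ℝ) (hA : A.IsSymm)
    (hA01 : ∀ i j, A i j ∈ Set.Icc (0 : ℝ) 1) : Graphon where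
  kernel := stepKernel A
  measurable_kernel := by
    have h : ∀ i, Measurable ((cell n i).indicator (1 : I → ℝ)) := fun i =>
      measurable_one.indicator (measurableSet_cell n i)
    change Measurable fun p : I × I =>
      ∑ i, ∑ j, A i j * (cell n i).indicator 1 p.1 * (cell n j).indicator 1 p.2
    refine Finset.measurable_fun_sum Finset.univ fun i _ =>
      Finset.measurable_fun_sum Finset.univ fun j _ => ?_
    exact
      (measurable_const.mul ((h i).comp measurable_fst)).mul ((h j).comp measurable_snd)
  symm x y := by
    unfold stepKernel
    rw [Finset.sum_comm]
    refine Finset.sum_congr rfl fun j _ => Finset.sum_congr rfl fun i _ => ?_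
    rw [hA.apply j i]
    ring
  mem_Icc x y := by
    by_cases hx : ∃ i, x ∈ cell n i
    · by_cases hy : ∃ j, y ∈ cell n j
      · obtain ⟨i, hi⟩ := hx
        obtain ⟨j, hj⟩ := hy
        rw [stepKernel_of_mem A hi hj]
        exact hA01 i j
      · rw [stepKernel_eq_zero A (Or.inr (not_exists.1 hy))]
        simp
    · rw [stepKernel_eq_zero A (Or.inl (not_exists.1 hx))]
      simp

/-- The sampled weighted adjacency matrix `A i j = W(uᵢ, uⱼ)`. -/
def sampledMatrix (W : Graphon) {n : ℕ} (u : Fin n → I) : Matrix (Fin n) (Fin n) ℝ :=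
  Matrix.of fun i j => W.kernel (u i) (u j)

/-- The step graphon of the sorted sample: its value on `cell i × cell j` is `W(u₍ᵢ₎, u₍ⱼ₎)`, where
`u₍ᵢ₎ = u (Tuple.sort u i)` are the order statistics of `u`. -/
noncomputable def sortedStep (W : Graphon) {n : ℕ} (u : Fin n → I) : Graphon :=
  step ((W.sampledMatrix u).submatrix (Tuple.sort u) (Tuple.sort u))
    (Matrix.IsSymm.ext fun _ _ => W.symm _ _) (fun _ _ => W.mem_Icc _ _)

/-- The error `ε_n`, the `L² → L²` operator norm of the difference between the integral operators
of the step graphon of the sorted sample and of `W`. -/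
noncomputable def samplingError (W : Graphon) {n : ℕ} (u : Fin n → I) : ℝ :=
  ‖(W.sortedStep u).operator - W.operator‖

end Graphon

/-- `u₁, …, u_n` are i.i.d. random variables, uniform on `[0,1]`, on the space `(Ω, P)`. -/
structure IsUniformSample {Ω : Type*} [MeasurableSpace Ω] (P : Measure Ω) {n : ℕ}
    (u : Fin n → Ω → I) : Prop where
  measurable : ∀ i, Measurable (u i)
  indep : iIndepFun u P
  uniform : ∀ i, P.map (u i) = volume

/-- `X_n = O_p(r_n)`: for every `η > 0` there is `M` such that `P_n(|X_n| > M |r_n|) ≤ η` for all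
large `n`. The variables `X_n` may live on different probability spaces. -/
def IsBigOInProbability {Ω : ℕ → Type*} [∀ n, MeasurableSpace (Ω n)] (P : ∀ n, Measure (Ω n))
    (X : ∀ n, Ω n → ℝ) (r : ℕ → ℝ) : Prop :=
  ∀ η : ℝ, 0 < η → ∃ M : ℝ, 0 < M ∧
    ∀ᶠ n in atTop, P n {ω | M * |r n| < |X n ω|} ≤ ENNReal.ofReal η

namespace Graphon

/-! Let `Q` be the empirical quantile function, equal to the `i`-th order statistic on the `i`-th
cell, and let `d(x) = |Q(x) - x|`. Off a null set the step graphon is `W(Q(x), Q(y))`, so the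
Lipschitz bound controls its difference from `W` by `L (d(x) + d(y))`. Cauchy-Schwarz turns this
into `samplingError ≤ 2L ‖d‖₂` (`samplingError_le`), and only `‖d‖₂` is random.

No supremum over `x` is needed. For fixed `x`, the event `d(x) > s` is a deviation of a count of
sample points below a threshold, so Hoeffding gives the tail `2 exp(-2ns²)`
(`measure_lt_deviation_le`) and hence `E exp(n d(x)²) ≤ 3`. Jensen in `x` and Tonelli give `E exp(n
‖d‖₂²) ≤ 3`, and Markov gives the tail of `‖d‖₂` (`measure_lt_norm_deviationL2_le`). The cells match
the jumps of the empirical distribution function exactly, so the `1/n` term of the theorem is slack.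
-/

lemma exists_mem_cell {n : ℕ} (hn : 0 < n) {x : I} (hx : 0 < (x : ℝ)) : ∃ i, x ∈ cell n i := by
  have hn' : (0 : ℝ) < n := by exact_mod_cast hn
  have hpos : 0 < (n : ℝ) * x := mul_pos hn' hx
  have hceil : 0 < ⌈(n : ℝ) * x⌉₊ := Nat.ceil_pos.2 hpos
  have hle : ⌈(n : ℝ) * x⌉₊ ≤ n :=
    Nat.ceil_le.2 (mul_le_of_le_one_right hn'.le x.2.2)
  have hcast : ((⌈(n : ℝ) * x⌉₊ - 1 : ℕ) : ℝ) = (⌈(n : ℝ) * x⌉₊ : ℝ) - 1 := by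
    rw [Nat.cast_sub hceil, Nat.cast_one]
  -- Cells are open on the left and indexed from `0`, hence ceiling minus one rather than floor.
  refine ⟨⟨⌈(n : ℝ) * x⌉₊ - 1, by omega⟩, ?_, ?_⟩
  · rw [div_lt_iff₀ hn']
    have := Nat.ceil_lt_add_one hpos.le
    simp only [hcast]
    linarith
  · rw [le_div_iff₀ hn']
    have := Nat.le_ceil ((n : ℝ) * x)
    simp only [hcast]
    linarith

lemma ae_pos : ∀ᵐ x : I, 0 < (x : ℝ) := by
  have h : ∀ᵐ x : I, x ≠ 0 := by
    rw [ae_iff]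
    simp
  filter_upwards [h] with x hx
  exact unitInterval.pos_iff_ne_zero.2 hx

/-! ### Order statistics and the empirical quantile function -/

/-- The order statistics `u₍₀₎ ≤ … ≤ u₍ₙ₋₁₎` of a finite sequence. -/
noncomputable def orderStat {n : ℕ} (u : Fin n → I) (i : Fin n) : I := u (Tuple.sort u i)

/-- Sorting only permutes the sample, so counts are unchanged. Both measurability and tail bounds
for order statistics reduce to counts through this. -/
lemma orderStat_le_iff {n : ℕ} (u : Fin n → I) (i : Fin n) (t : I) :
    orderStat u i ≤ t ↔ (i : ℕ) < (Finset.univ.filter fun j => u j ≤ t).card := by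
  have h := Tuple.lt_card_le_iff_apply_le_of_monotone (j := i) (a := t) (Tuple.monotone_sort u)
  have hcard : (Finset.univ.filter fun j => (u ∘ Tuple.sort u) j ≤ t).card =
      (Finset.univ.filter fun j => u j ≤ t).card := by
    refine Finset.card_bij (fun j _ => Tuple.sort u j) (by simp) (by simp) fun b hb => ?_
    exact ⟨(Tuple.sort u).symm b, by simpa using hb, by simp⟩
  rw [← hcard, h]
  rfl

/-- The distance `|Qₙ(x) - x|` between the empirical quantile function `Qₙ` of `u`, equal to
`u₍ᵢ₎` on the `i`-th cell, and the identity. -/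
noncomputable def deviation {n : ℕ} (u : Fin n → I) (x : I) : ℝ :=
  ∑ i, (cell n i).indicator (fun y => |(orderStat u i : ℝ) - y|) x

lemma deviation_of_mem {n : ℕ} (u : Fin n → I) {i : Fin n} {x : I} (hx : x ∈ cell n i) :
    deviation u x = |(orderStat u i : ℝ) - x| := by
  unfold deviation
  rw [Finset.sum_eq_single i]
  · simp [hx]
  · intro k _ hk
    have : x ∉ cell n k := fun h => hk (cell_unique h hx)
    simp [this]
  · simp

lemma deviation_of_notMem {n : ℕ} (u : Fin n → I) {x : I} (hx : ∀ i, x ∉ cell n i) :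
    deviation u x = 0 :=
  Finset.sum_eq_zero fun i _ => by simp [hx i]

lemma deviation_nonneg {n : ℕ} (u : Fin n → I) (x : I) : 0 ≤ deviation u x :=
  Finset.sum_nonneg fun _ _ => Set.indicator_nonneg (fun _ _ => abs_nonneg _) _

lemma deviation_le_one {n : ℕ} (u : Fin n → I) (x : I) : deviation u x ≤ 1 := by
  by_cases hx : ∃ i, x ∈ cell n i
  · obtain ⟨i, hi⟩ := hx
    rw [deviation_of_mem u hi, abs_le]
    constructor <;> linarith [(orderStat u i).2.1, (orderStat u i).2.2, x.2.1, x.2.2]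
  · rw [deviation_of_notMem u (not_exists.1 hx)]
    exact zero_le_one

lemma measurable_deviation {n : ℕ} (u : Fin n → I) : Measurable (deviation u) :=
  Finset.measurable_fun_sum Finset.univ fun i _ =>
    (measurable_const.sub measurable_subtype_coe).abs.indicator (measurableSet_cell n i)

lemma memLp_deviation {n : ℕ} (u : Fin n → I) :
    MemLp (deviation u) 2 (volume : Measure I) :=
  MemLp.of_bound (measurable_deviation u).aestronglyMeasurable 1 (Eventually.of_forall fun x => by
    rw [Real.norm_of_nonneg (deviation_nonneg u x)]
    exact deviation_le_one u x)

/-- The deviation as an element of `L²([0,1])`. -/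
noncomputable def deviationL2 {n : ℕ} (u : Fin n → I) : L2 := (memLp_deviation u).toLp _

lemma deviationL2_ae {n : ℕ} (u : Fin n → I) : deviationL2 u =ᵐ[volume] deviation u :=
  (memLp_deviation u).coeFn_toLp

lemma norm_deviationL2_sq {n : ℕ} (u : Fin n → I) :
    ‖deviationL2 u‖ ^ 2 = ∫ x, deviation u x ^ 2 := by
  rw [← real_inner_self_eq_norm_sq, L2.inner_def]
  refine integral_congr_ae ?_
  filter_upwards [deviationL2_ae u] with x hx
  simp [hx]

/-! ### Deterministic bound on the operator norm -/

lemma integral_deviation_mul_abs_le {n : ℕ} (u : Fin n → I) (f : L2) :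
    ∫ x, deviation u x * |f x| ≤ ‖deviationL2 u‖ * ‖f‖ := by
  have h := real_inner_le_norm (deviationL2 u) |f|
  rw [norm_abs_eq_norm, L2.inner_def] at h
  refine le_trans (le_of_eq (integral_congr_ae ?_)) h
  filter_upwards [deviationL2_ae u, Lp.coeFn_abs f] with x hx hf
  simp [hx, hf, mul_comm]

lemma IsLipschitz.nonneg {W : Graphon} {L : ℝ} (hW : W.IsLipschitz L) : 0 ≤ L := by
  have h := (abs_nonneg _).trans (hW 0 0 1 0)
  simpa using h

lemma abs_sortedStep_sub_le {W : Graphon} {L : ℝ} (hW : W.IsLipschitz L) {n : ℕ} (hn : 0 < n)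
    (u : Fin n → I) {x y : I} (hx : 0 < (x : ℝ)) (hy : 0 < (y : ℝ)) :
    |(W.sortedStep u).kernel x y - W.kernel x y| ≤ L * (deviation u x + deviation u y) := by
  obtain ⟨i, hi⟩ := exists_mem_cell hn hx
  obtain ⟨j, hj⟩ := exists_mem_cell hn hy
  rw [deviation_of_mem u hi, deviation_of_mem u hj]
  have h : (W.sortedStep u).kernel x y = W.kernel (orderStat u i) (orderStat u j) :=
    stepKernel_of_mem _ hi hj
  rw [h]
  exact hW _ _ _ _

lemma abs_applyFun_sub_le {W : Graphon} {L : ℝ} (hW : W.IsLipschitz L) {n : ℕ} (hn : 0 < n)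
    (u : Fin n → I) (f : L2) {x : I} (hx : 0 < (x : ℝ)) :
    |(W.sortedStep u).applyFun f x - W.applyFun f x| ≤
      L * ‖f‖ * (deviation u x + ‖deviationL2 u‖) := by
  have hL := hW.nonneg
  have hf : Integrable (fun y => |f y|) volume := (integrable_L2 f).abs
  have hdf : Integrable (fun y => deviation u y * |f y|) volume :=
    hf.bdd_mul (c := 1) (measurable_deviation u).aestronglyMeasurable
      (Eventually.of_forall fun y => by
        rw [Real.norm_of_nonneg (deviation_nonneg u y)]
        exact deviation_le_one u y)
  have hint : Integrable
      (fun y => L * (deviation u x * |f y| + deviation u y * |f y|)) volume :=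
    ((hf.const_mul _).add hdf).const_mul _
  unfold applyFun
  rw [← integral_sub (integrable_kernel_mul _ f x) (integrable_kernel_mul _ f x),
    ← Real.norm_eq_abs]
  calc _ ≤ ∫ y, L * (deviation u x * |f y| + deviation u y * |f y|) := by
        refine norm_integral_le_of_norm_le hint ?_
        filter_upwards [ae_pos] with y hy
        rw [← sub_mul, norm_mul, Real.norm_eq_abs, Real.norm_eq_abs, ← add_mul, ← mul_assoc]
        exact mul_le_mul_of_nonneg_right (abs_sortedStep_sub_le hW hn u hx hy) (abs_nonneg _)
    _ = L * (deviation u x * ∫ y, |f y|) + L * ∫ y, deviation u y * |f y| := by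
        rw [integral_const_mul, integral_add (hf.const_mul _) hdf, integral_const_mul, mul_add]
    -- The first term uses `‖f‖₁ ≤ ‖f‖₂` on a probability space, the second Cauchy-Schwarz.
    _ ≤ L * (deviation u x * ‖f‖) + L * (‖deviationL2 u‖ * ‖f‖) := by
        gcongr
        · exact deviation_nonneg u x
        · exact integral_norm_le f
        · exact integral_deviation_mul_abs_le u f
    _ = _ := by ring

/-- The error is at most `2L` times the `L²` distance between the empirical quantile function and
the identity. -/
lemma samplingError_le {W : Graphon} {L : ℝ} (hW : W.IsLipschitz L) {n : ℕ} (hn : 0 < n)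
    (u : Fin n → I) : W.samplingError u ≤ 2 * L * ‖deviationL2 u‖ := by
  have hL := hW.nonneg
  refine ContinuousLinearMap.opNorm_le_bound _ (by positivity) fun f => ?_
  -- The interval has total mass one, so a constant keeps its absolute value as norm; each of the
  -- two summands then contributes `‖deviationL2 u‖`.
  have hconst : ‖Lp.const 2 (volume : Measure I) ‖deviationL2 u‖‖ = ‖deviationL2 u‖ := by
    rw [Lp.norm_const _ _ _ (by norm_num)]
    simp
  calc _ ≤ ‖(L * ‖f‖) • (deviationL2 u + Lp.const 2 (volume : Measure I) ‖deviationL2 u‖)‖ := by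
        refine Lp.norm_le_norm_of_ae_le ?_
        rw [sub_apply]
        filter_upwards [Lp.coeFn_sub ((W.sortedStep u).operator f) (W.operator f),
          (W.sortedStep u).operator_apply_ae f, W.operator_apply_ae f, ae_pos,
          Lp.coeFn_smul (L * ‖f‖)
            (deviationL2 u + Lp.const 2 (volume : Measure I) ‖deviationL2 u‖),
          Lp.coeFn_add (deviationL2 u) (Lp.const 2 (volume : Measure I) ‖deviationL2 u‖),
          Lp.coeFn_const 2 (volume : Measure I) ‖deviationL2 u‖, deviationL2_ae u]
          with x h1 h2 h3 hx h4 h5 h6 h7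
        rw [h1, Pi.sub_apply, h2, h3, h4, Pi.smul_apply, h5, Pi.add_apply, h6, h7, smul_eq_mul,
          Real.norm_eq_abs, Real.norm_eq_abs, Function.const_apply]
        exact (abs_applyFun_sub_le hW hn u f hx).trans (le_abs_self _)
    _ ≤ (L * ‖f‖) * (‖deviationL2 u‖ + ‖deviationL2 u‖) := by
        rw [norm_smul, Real.norm_of_nonneg (by positivity)]
        gcongr
        exact (norm_add_le _ _).trans (by rw [hconst])
    _ = _ := by ring

end Graphon

/-! ### Measurability in the sample -/

namespace Graphon

variable {Ω : Type*} [MeasurableSpace Ω] {P : Measure Ω} {n : ℕ} {u : Fin n → Ω → I}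

lemma measurable_card_le (hu : ∀ i, Measurable (u i)) (t : I) :
    Measurable fun ω => (Finset.univ.filter fun j => u j ω ≤ t).card := by
  simp only [Finset.card_filter]
  exact Finset.measurable_fun_sum _ fun j _ =>
    Measurable.ite (measurableSet_le (hu j) measurable_const) measurable_const measurable_const

lemma measurable_orderStat (hu : ∀ i, Measurable (u i)) (i : Fin n) :
    Measurable fun ω => orderStat (fun j => u j ω) i := by
  refine measurable_of_Iic fun t => ?_
  have h : (fun ω => orderStat (fun j => u j ω) i) ⁻¹' Set.Iic t =
      {ω | (i : ℕ) < (Finset.univ.filter fun j => u j ω ≤ t).card} := by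
    ext ω
    exact orderStat_le_iff _ i t
  rw [h]
  exact measurableSet_lt measurable_const (measurable_card_le hu t)

/-- Joint measurability is what Tonelli needs later. -/
lemma measurable_uncurry_deviation (hu : ∀ i, Measurable (u i)) :
    Measurable fun p : Ω × I => deviation (fun j => u j p.1) p.2 := by
  refine Finset.measurable_fun_sum Finset.univ fun i _ => ?_
  have h : Measurable fun p : Ω × I => |(orderStat (fun j => u j p.1) i : ℝ) - p.2| :=
    ((measurable_subtype_coe.comp ((measurable_orderStat hu i).comp measurable_fst)).sub
      (measurable_subtype_coe.comp measurable_snd)).abs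
  exact h.indicator (measurable_snd (measurableSet_cell n i))

end Graphon

/-! ### Pointwise tails and exponential moments -/

namespace IsUniformSample

lemma sum_indicator_sub {n : ℕ} (v : Fin n → I) (t : I) :
    ∑ j, ((Set.Iic t).indicator (1 : I → ℝ) (v j) - t) =
      (Finset.univ.filter fun j => v j ≤ t).card - n * (t : ℝ) := by
  simp [Finset.sum_sub_distrib, Set.indicator_apply]

variable {Ω : Type*} [MeasurableSpace Ω] {P : Measure Ω} {n : ℕ} {u : Fin n → Ω → I}

lemma hasSubgaussianMGF [IsProbabilityMeasure P] (hu : IsUniformSample P u) (t : I) (j : Fin n) :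
    HasSubgaussianMGF (fun ω => (Set.Iic t).indicator (1 : I → ℝ) (u j ω) - t) (1 / 4) P := by
  have hmeas : Measurable ((Set.Iic t).indicator (1 : I → ℝ)) :=
    measurable_one.indicator measurableSet_Iic
  have h := hasSubgaussianMGF_of_mem_Icc (μ := P) (a := 0) (b := 1)
    (hmeas.comp (hu.measurable j)).aemeasurable
    (Eventually.of_forall fun ω => by
      by_cases h : u j ω ≤ t <;> simp [Set.indicator, h])
  have hmean : ∫ ω, (((Set.Iic t).indicator (1 : I → ℝ)) ∘ u j) ω ∂P = t := by
    simp only [Function.comp_apply]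
    rw [← integral_map (hu.measurable j).aemeasurable hmeas.aestronglyMeasurable, hu.uniform j,
      integral_indicator_one measurableSet_Iic, measureReal_def, unitInterval.volume_Iic,
      ENNReal.toReal_ofReal t.2.1]
  rw [hmean] at h
  have hc : ((‖(1 : ℝ) - 0‖₊ / 2) ^ 2 : NNReal) = 1 / 4 := by
    rw [sub_zero, nnnorm_one]
    norm_num
  rwa [hc] at h

lemma iIndepFun_indicator_sub (hu : IsUniformSample P u) (t : I) :
    iIndepFun (fun j ω => (Set.Iic t).indicator (1 : I → ℝ) (u j ω) - t) P :=
  hu.indep.comp (fun _ y => (Set.Iic t).indicator (1 : I → ℝ) y - t)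
    fun _ => (measurable_one.indicator measurableSet_Iic).sub measurable_const

/-- Upper Hoeffding bound for the empirical distribution function of a uniform sample. -/
lemma measureReal_card_sub_ge_le [IsProbabilityMeasure P] (hu : IsUniformSample P u)
    (hn : 0 < n) (t : I) {s : ℝ} (hs : 0 ≤ s) :
    P.real {ω | n * s ≤ (Finset.univ.filter fun j => u j ω ≤ t).card - n * (t : ℝ)} ≤
      Real.exp (-2 * n * s ^ 2) := by
  have h := HasSubgaussianMGF.measure_sum_ge_le_of_iIndepFun (hu.iIndepFun_indicator_sub t)
    (s := Finset.univ) (fun j _ => hu.hasSubgaussianMGF t j) (ε := n * s) (by positivity)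
  simp only [sum_indicator_sub fun j => u j _] at h
  refine h.trans (le_of_eq ?_)
  congr 1
  have : (n : ℝ) ≠ 0 := by positivity
  simp
  field_simp
  norm_num

/-- Lower Hoeffding bound for the empirical distribution function of a uniform sample. -/
lemma measureReal_card_sub_le_le [IsProbabilityMeasure P] (hu : IsUniformSample P u)
    (hn : 0 < n) (t : I) {s : ℝ} (hs : 0 ≤ s) :
    P.real {ω | n * s ≤ n * (t : ℝ) - (Finset.univ.filter fun j => u j ω ≤ t).card} ≤
      Real.exp (-2 * n * s ^ 2) := by
  have hind : iIndepFun (fun j => -fun ω => (Set.Iic t).indicator (1 : I → ℝ) (u j ω) - (t : ℝ)) P :=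
    (hu.iIndepFun_indicator_sub t).comp (fun _ y => -y) fun _ => measurable_neg
  have h := HasSubgaussianMGF.measure_sum_ge_le_of_iIndepFun hind
    (s := Finset.univ) (fun j _ => (hu.hasSubgaussianMGF t j).neg) (ε := n * s) (by positivity)
  simp only [Pi.neg_apply, Finset.sum_neg_distrib, sum_indicator_sub fun j => u j _] at h
  simp only [neg_sub] at h
  refine h.trans (le_of_eq ?_)
  congr 1
  have : (n : ℝ) ≠ 0 := by positivity
  simp
  field_simp
  norm_num

open Graphon

/-- Subgaussian tail of the empirical quantile function at a point. -/
lemma measure_lt_deviation_le [IsProbabilityMeasure P] (hu : IsUniformSample P u)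
    (hn : 0 < n) (x : I) {s : ℝ} (hs : 0 ≤ s) :
    P {ω | s < deviation (fun j => u j ω) x} ≤ ENNReal.ofReal (2 * Real.exp (-2 * n * s ^ 2)) := by
  have hn' : (0 : ℝ) < n := by exact_mod_cast hn
  by_cases hx : ∃ i, x ∈ cell n i
  swap
  · have h : {ω | s < deviation (fun j => u j ω) x} = ∅ := by
      ext ω
      simp [deviation_of_notMem _ (not_exists.1 hx), hs]
    simp [h]
  obtain ⟨i, hi⟩ := hx
  have hi1 : (i : ℝ) < n * x := by
    have := (div_lt_iff₀ hn').1 hi.1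
    linarith
  have hi2 : (n : ℝ) * x ≤ i + 1 := by
    have := (le_div_iff₀ hn').1 hi.2
    linarith
  -- If the order statistic is below `x - s`, at least `i + 1 ≥ n x` points lie below `x - s`, an
  -- excess of `n s` over the mean. For `x - s < 0` the event is empty.
  have hlow : P {ω | (orderStat (fun j => u j ω) i : ℝ) < x - s} ≤
      ENNReal.ofReal (Real.exp (-2 * n * s ^ 2)) := by
    by_cases ht : 0 ≤ (x : ℝ) - s
    · refine le_trans (measure_mono fun ω hω => ?_) (ENNReal.le_ofReal_iff_toReal_le
        (measure_ne_top _ _) (Real.exp_nonneg _) |>.2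
        (hu.measureReal_card_sub_ge_le hn ⟨x - s, ht, by linarith [x.2.2]⟩ hs))
      have h1 := (orderStat_le_iff (fun j => u j ω) i ⟨x - s, ht, by linarith [x.2.2]⟩).1
        (le_of_lt hω)
      have h2 : (i : ℝ) + 1 ≤
          (Finset.univ.filter fun j => u j ω ≤ ⟨x - s, ht, by linarith [x.2.2]⟩).card := by
        exact_mod_cast h1
      simp only [Set.mem_ofPred_eq]
      linarith
    · have h : {ω | (orderStat (fun j => u j ω) i : ℝ) < x - s} = ∅ := by
        ext ω
        simp only [Set.mem_ofPred_eq, Set.mem_empty_iff_false, iff_false]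
        linarith [(orderStat (fun j => u j ω) i).2.1]
      simp [h]
  -- Symmetrically, at most `i < n x` points lie below `x + s`, a deficit of at least `n s`.
  have hupp : P {ω | (x : ℝ) + s < orderStat (fun j => u j ω) i} ≤
      ENNReal.ofReal (Real.exp (-2 * n * s ^ 2)) := by
    by_cases ht : (x : ℝ) + s ≤ 1
    · refine le_trans (measure_mono fun ω hω => ?_) (ENNReal.le_ofReal_iff_toReal_le
        (measure_ne_top _ _) (Real.exp_nonneg _) |>.2
        (hu.measureReal_card_sub_le_le hn ⟨x + s, by linarith [x.2.1], ht⟩ hs))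
      have h1 := (orderStat_le_iff (fun j => u j ω) i ⟨x + s, by linarith [x.2.1], ht⟩).not.1
        (not_le_of_gt hω)
      have h2 : ((Finset.univ.filter
          fun j => u j ω ≤ ⟨x + s, by linarith [x.2.1], ht⟩).card : ℝ) ≤ i := by
        exact_mod_cast not_lt.1 h1
      simp only [Set.mem_ofPred_eq]
      linarith
    · have h : {ω | (x : ℝ) + s < orderStat (fun j => u j ω) i} = ∅ := by
        ext ω
        simp only [Set.mem_ofPred_eq, Set.mem_empty_iff_false, iff_false]
        linarith [(orderStat (fun j => u j ω) i).2.2]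
      simp [h]
  calc _ ≤ P ({ω | (orderStat (fun j => u j ω) i : ℝ) < x - s} ∪
        {ω | (x : ℝ) + s < orderStat (fun j => u j ω) i}) := by
        refine measure_mono fun ω hω => ?_
        rw [Set.mem_ofPred_eq, deviation_of_mem _ hi, lt_abs] at hω
        rcases hω with h | h
        · exact Or.inr (by simp only [Set.mem_ofPred_eq]; linarith)
        · exact Or.inl (by simp only [Set.mem_ofPred_eq]; linarith)
    _ ≤ _ := measure_union_le _ _
    _ ≤ _ := add_le_add hlow hupp
    _ = _ := by rw [← ENNReal.ofReal_add (Real.exp_nonneg _) (Real.exp_nonneg _), two_mul]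

/-- Layer cake: `exp a = 1 + ∫₀ᵃ eᵗ dt`, and the tail `2e⁻²ᵗ` of `n d²` against `eᵗ` integrates to
`2`. -/
lemma lintegral_exp_deviation_le [IsProbabilityMeasure P] (hu : IsUniformSample P u)
    (hn : 0 < n) (x : I) :
    ∫⁻ ω, ENNReal.ofReal (Real.exp (n * deviation (fun j => u j ω) x ^ 2)) ∂P ≤ 3 := by
  have hn' : (0 : ℝ) < n := by exact_mod_cast hn
  have hmeas : Measurable fun ω => (n : ℝ) * deviation (fun j => u j ω) x ^ 2 :=
    (((measurable_uncurry_deviation hu.measurable).comp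
      measurable_prodMk_right).pow_const 2).const_mul _
  have hlayer := lintegral_comp_eq_lintegral_meas_lt_mul (g := Real.exp) P
    (Eventually.of_forall fun ω => by
      change 0 ≤ (n : ℝ) * deviation (fun j => u j ω) x ^ 2
      positivity) hmeas.aemeasurable
    (fun t _ => Real.continuous_exp.intervalIntegrable 0 t)
    (Eventually.of_forall Real.exp_nonneg)
  have htail : ∫⁻ t in Set.Ioi (0 : ℝ), P {ω | t < n * deviation (fun j => u j ω) x ^ 2} *
      ENNReal.ofReal (Real.exp t) ≤ 2 := by
    calc _ ≤ ∫⁻ t in Set.Ioi (0 : ℝ), ENNReal.ofReal (2 * Real.exp (-t)) := by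
          refine setLIntegral_mono (by fun_prop) fun t ht => ?_
          have ht : 0 < t := ht
          have hset : {ω | t < n * deviation (fun j => u j ω) x ^ 2} =
              {ω | Real.sqrt (t / n) < deviation (fun j => u j ω) x} := by
            ext ω
            simp only [Set.mem_ofPred_eq]
            rw [← Real.sqrt_sq (deviation_nonneg (fun j => u j ω) x),
              Real.sqrt_lt_sqrt_iff (by positivity), Real.sqrt_sq (deviation_nonneg _ x),
              div_lt_iff₀' hn']
          rw [hset]
          refine (mul_le_mul_left (hu.measure_lt_deviation_le hn x (Real.sqrt_nonneg _)) _).trans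
            (le_of_eq ?_)
          rw [← ENNReal.ofReal_mul (by positivity), mul_assoc, ← Real.exp_add,
            Real.sq_sqrt (by positivity)]
          congr 3
          field_simp
          ring
      _ = ENNReal.ofReal (∫ t in Set.Ioi (0 : ℝ), 2 * Real.exp (-t)) := by
          rw [ofReal_integral_eq_lintegral_ofReal ((integrableOn_exp_neg_Ioi 0).const_mul 2)
            (Eventually.of_forall fun t => by positivity)]
      _ = 2 := by
          rw [integral_const_mul, integral_exp_neg_Ioi_zero]
          simp
  calc _ = ∫⁻ ω, (ENNReal.ofReal (∫ t in (0 : ℝ)..n * deviation (fun j => u j ω) x ^ 2,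
        Real.exp t) + 1) ∂P := by
        refine lintegral_congr fun ω => ?_
        have h : (1 : ℝ) ≤ Real.exp (n * deviation (fun j => u j ω) x ^ 2) :=
          Real.one_le_exp (by positivity)
        rw [integral_exp, Real.exp_zero, ← ENNReal.ofReal_one,
          ← ENNReal.ofReal_add (by linarith) zero_le_one, sub_add_cancel]
    _ ≤ 2 + 1 := by
        rw [lintegral_add_right _ measurable_const, hlayer]
        refine add_le_add htail ?_
        simp
    _ = 3 := by norm_num

end IsUniformSample

/-! ### Concentration in L² and of the sampling error -/

namespace Graphon

/-- Jensen for `exp` under the uniform law of `x`. -/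
lemma ofReal_exp_norm_deviationL2_le {n : ℕ} (v : Fin n → I) :
    ENNReal.ofReal (Real.exp (n * ‖deviationL2 v‖ ^ 2)) ≤
      ∫⁻ x, ENNReal.ofReal (Real.exp (n * deviation v x ^ 2)) := by
  have hsq : Integrable (fun x => (n : ℝ) * deviation v x ^ 2) volume :=
    ((memLp_deviation v).integrable_sq).const_mul _
  have hexp : Integrable (Real.exp ∘ fun x => (n : ℝ) * deviation v x ^ 2) volume := by
    refine Integrable.of_bound
      (Real.continuous_exp.comp_aestronglyMeasurable hsq.aestronglyMeasurable)
      (Real.exp n) (Eventually.of_forall fun x => ?_)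
    rw [Function.comp_apply, Real.norm_of_nonneg (Real.exp_nonneg _)]
    exact Real.exp_le_exp.2 (mul_le_of_le_one_right (Nat.cast_nonneg n)
      (pow_le_one₀ (deviation_nonneg v x) (deviation_le_one v x)))
  have h := convexOn_exp.map_integral_le Real.continuous_exp.continuousOn isClosed_univ
    (Eventually.of_forall fun _ => Set.mem_univ _) hsq hexp
  rw [norm_deviationL2_sq, ← integral_const_mul]
  refine (ENNReal.ofReal_le_ofReal h).trans (le_of_eq ?_)
  exact ofReal_integral_eq_lintegral_ofReal hexp (Eventually.of_forall fun _ => Real.exp_nonneg _)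

end Graphon

namespace IsUniformSample

open Graphon

variable {Ω : Type*} [MeasurableSpace Ω] {P : Measure Ω} {n : ℕ} {u : Fin n → Ω → I}

/-- Concentration of the `L²` distance between the empirical quantile function of a uniform sample
and the identity. -/
lemma measure_lt_norm_deviationL2_le [IsProbabilityMeasure P] (hu : IsUniformSample P u)
    (hn : 0 < n) {s : ℝ} (hs : 0 ≤ s) :
    P {ω | s < ‖deviationL2 (fun j => u j ω)‖} ≤ ENNReal.ofReal (3 * Real.exp (-(n * s ^ 2))) := by
  have hmeas : Measurable fun p : Ω × I =>
      ENNReal.ofReal (Real.exp (n * deviation (fun j => u j p.1) p.2 ^ 2)) :=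
    ((((measurable_uncurry_deviation hu.measurable).pow_const 2).const_mul _).exp).ennreal_ofReal
  have hle : ∫⁻ ω, (∫⁻ x, ENNReal.ofReal
      (Real.exp (n * deviation (fun j => u j ω) x ^ 2))) ∂P ≤ 3 := by
    -- After the swap the pointwise moment bound applies for each fixed `x`; Markov then finishes.
    rw [lintegral_lintegral_swap hmeas.aemeasurable]
    refine (lintegral_mono fun x => hu.lintegral_exp_deviation_le hn x).trans ?_
    simp
  calc _ ≤ P {ω | ENNReal.ofReal (Real.exp (n * s ^ 2)) ≤
        ∫⁻ x, ENNReal.ofReal (Real.exp (n * deviation (fun j => u j ω) x ^ 2))} := by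
        refine measure_mono fun ω hω => ?_
        have hω : s < ‖deviationL2 (fun j => u j ω)‖ := hω
        exact le_trans (by gcongr) (ofReal_exp_norm_deviationL2_le fun j => u j ω)
    _ ≤ _ := meas_ge_le_lintegral_div hmeas.lintegral_prod_right'.aemeasurable
        (by simp [Real.exp_pos]) ENNReal.ofReal_ne_top
    _ ≤ 3 / ENNReal.ofReal (Real.exp (n * s ^ 2)) := ENNReal.div_le_div_right hle _
    _ = _ := by
        rw [Real.exp_neg, ← div_eq_mul_inv, ENNReal.ofReal_div_of_pos (Real.exp_pos _)]
        norm_num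

lemma measure_not_samplingError_le [IsProbabilityMeasure P] (hu : IsUniformSample P u)
    (hn : 0 < n) {W : Graphon} {L : ℝ} (hW : W.IsLipschitz L) {δ : ℝ} (hδ : 0 < δ) (hδ1 : δ < 1)
    {r : ℝ} (hr : 4 * Real.sqrt (Real.log (2 / δ) / n) ≤ r) :
    P {ω | ¬ W.samplingError (fun i => u i ω) ≤ L * r} ≤ ENNReal.ofReal δ := by
  have hn' : (0 : ℝ) < n := by exact_mod_cast hn
  have hlog : 0 ≤ Real.log (2 / δ) := Real.log_nonneg (by rw [le_div_iff₀ hδ]; linarith)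
  -- This `s` gives `n s² = 4 log (2/δ)`, so the tail is `3 (δ/2)⁴ ≤ δ`; the factor `2L` in front of
  -- the norm yields the constant `4`.
  refine (measure_mono fun ω hω => ?_).trans ((hu.measure_lt_norm_deviationL2_le hn
    (s := 2 * Real.sqrt (Real.log (2 / δ) / n)) (by positivity)).trans
      (ENNReal.ofReal_le_ofReal ?_))
  · by_contra h
    rw [Set.mem_ofPred_eq, not_lt] at h
    refine hω ((samplingError_le hW hn _).trans ?_)
    rw [mul_comm 2 L, mul_assoc]
    exact mul_le_mul_of_nonneg_left (by linarith) hW.nonneg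
  · rw [mul_pow, Real.sq_sqrt (by positivity)]
    have hexp : (n : ℝ) * (2 ^ 2 * (Real.log (2 / δ) / n)) = (4 : ℕ) * Real.log (2 / δ) := by
      push_cast
      field_simp
      ring
    rw [hexp, Real.exp_neg, Real.exp_nat_mul, Real.exp_log (by positivity), div_pow, inv_div]
    have : δ ^ 4 ≤ δ := pow_le_of_le_one hδ.le hδ1.le (by norm_num)
    linarith

lemma measure_not_samplingError_le_rpow [IsProbabilityMeasure P] (hu : IsUniformSample P u)
    (hn : 2 ≤ n) {W : Graphon} {L : ℝ} (hW : W.IsLipschitz L) {c : ℝ} (hc : 0 < c) :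
    P {ω | ¬ W.samplingError (fun i => u i ω) ≤
      4 * Real.sqrt (1 + c) * L * Real.sqrt (Real.log n / n)} ≤
        ENNReal.ofReal ((n : ℝ) ^ (-c)) := by
  have hn2 : (2 : ℝ) ≤ n := by exact_mod_cast hn
  have hn' : (0 : ℝ) < n := by linarith
  have h := hu.measure_not_samplingError_le (by omega) hW (Real.rpow_pos_of_pos hn' (-c))
    (Real.rpow_lt_one_of_one_lt_of_neg (by linarith) (by linarith))
    (r := 4 * Real.sqrt (1 + c) * Real.sqrt (Real.log n / n)) (by
      -- For `δ = n⁻ᶜ`, `log (2/δ) = log 2 + c log n ≤ (1 + c) log n` because `n ≥ 2`.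
      rw [mul_assoc, ← Real.sqrt_mul (by linarith)]
      gcongr
      rw [mul_div_assoc']
      gcongr
      rw [Real.rpow_neg hn'.le, div_inv_eq_mul, Real.log_mul (by norm_num) (by positivity),
        Real.log_rpow hn', add_mul, one_mul]
      gcongr)
  rwa [← mul_assoc, mul_comm L] at h

end IsUniformSample

theorem mainTheorem2 :
    (∃ C : ℝ, 0 < C ∧
      ∀ (W : Graphon) (L : ℝ), W.IsLipschitz L →
      ∀ (n : ℕ), 0 < n →
      ∀ (Ω : Type*) [MeasurableSpace Ω] (P : Measure Ω) [IsProbabilityMeasure P]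
        (u : Fin n → Ω → I), IsUniformSample P u →
      ∀ δ : ℝ, 0 < δ → δ < 1 →
        P {ω | ¬ W.samplingError (fun i => u i ω) ≤
          C * L * (Real.sqrt (Real.log (2 / δ) / n) + 1 / n)} ≤ ENNReal.ofReal δ) ∧
    (∀ c : ℝ, 0 < c → ∃ K : ℝ, 0 < K ∧
      ∀ (W : Graphon) (L : ℝ), W.IsLipschitz L →
      ∀ (n : ℕ), 2 ≤ n →
      ∀ (Ω : Type*) [MeasurableSpace Ω] (P : Measure Ω) [IsProbabilityMeasure P]
        (u : Fin n → Ω → I), IsUniformSample P u →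
        P {ω | ¬ W.samplingError (fun i => u i ω) ≤
          K * L * Real.sqrt (Real.log n / n)} ≤ ENNReal.ofReal ((n : ℝ) ^ (-c))) ∧
    (∀ (W : Graphon) (L : ℝ), W.IsLipschitz L →
      ∀ (Ω : ℕ → Type*) [∀ n, MeasurableSpace (Ω n)] (P : ∀ n, Measure (Ω n))
        [∀ n, IsProbabilityMeasure (P n)] (u : ∀ n, Fin n → Ω n → I),
        (∀ n, IsUniformSample (P n) (u n)) →
        IsBigOInProbability P (fun n ω => W.samplingError (fun i => u n i ω))
          (fun n => Real.sqrt (Real.log n / n))) := by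
  refine ⟨⟨4, by norm_num, fun W L hW n hn Ω _ P _ u hu δ hδ hδ1 => ?_⟩, fun c hc =>
    ⟨4 * Real.sqrt (1 + c), by positivity, fun W L hW n hn Ω _ P _ u hu =>
      hu.measure_not_samplingError_le_rpow hn hW hc⟩, fun W L hW Ω _ P _ u hu η hη => ?_⟩
  · have h := hu.measure_not_samplingError_le hn hW hδ hδ1
      (r := 4 * (Real.sqrt (Real.log (2 / δ) / n) + 1 / n))
      (mul_le_mul_of_nonneg_left (le_add_of_nonneg_right (by positivity)) (by norm_num))
    rwa [← mul_assoc, mul_comm L] at h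
  · have hL := hW.nonneg
    -- The case `c = 1`, whose failure probability `1/n` is eventually below `η`; the added `1`
    -- keeps `M` positive when `L = 0`.
    refine ⟨4 * Real.sqrt (1 + 1) * L + 1, by positivity, ?_⟩
    filter_upwards [eventually_ge_atTop 2,
      tendsto_inv_atTop_nhds_zero_nat.eventually_le_const hη] with n hn hnη
    refine (measure_mono fun ω hω => ?_).trans
      (((hu n).measure_not_samplingError_le_rpow hn hW one_pos).trans
        (ENNReal.ofReal_le_ofReal (by rwa [Real.rpow_neg_one])))
    rw [Set.mem_ofPred_eq, abs_of_nonneg (Real.sqrt_nonneg _),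
      abs_of_nonneg (show 0 ≤ W.samplingError fun i => u n i ω from norm_nonneg _)] at hω
    refine not_le.2 (lt_of_le_of_lt ?_ hω)
    gcongr
    linarith
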